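/- Consider the following zero-sum game, with integer $n\ge 2$ and real $h$ satisfying $1\le h<n$. The Hider buries $2$ objects in $n$ locations, at non-negative depths (possibly both in the same location), such that the sum over the locations of the depth of the deepest object in that location (taken as $0$ if there is none) is at most $1$. The Searcher digs, possibly in several locations simultaneously, to a total depth of at most $h$; an object at depth $d$ in location $i$ is discovered as soon as the depth dug in location $i$ reaches $d$, and the Searcher may change his digging plan when he discovers the first object, depending on its location and depth. The payoff is $1$ if the Searcher discovers both objects and $0$ otherwise. Let $\underline V(n,h)$ be the supremum of the winning probabilities that the Searcher can guarantee with a mixed strategy, and $\overline V(n,h)$ the infimum of the upper bounds on the Searcher's winning probability that the Hider can guarantee with a mixed strategy, where mixed strategies are discrete probability distributions over pure strategies. The value $V(n,h)$ of the game lies in $[\underline V(n,h),\overline V(n,h)]$. **Theorem.** For all $n$ and $h$ with $1\le h<n$ and $h\ge n/2$, $$\frac hn-\frac 2n\;\le\;\underline V(n,h)\;\le\;\overline V(n,h)\;\le\;\frac{\lfloor h\rfloor}{n}.$$ Consequently the value satisfies $V(n,h)=h/n+o(1)$ as $n\to\infty$, uniformly in $h$: there is a sequence $\epsilon(n)\to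 0$, not depending on $h$, such that $|V-h/n|\le\epsilon(n)$ for all such $n$, $h$ and every $V\in[\underline V(n,h),\overline V(n,h)]$. -/

import Mathlib

open Filter Topology Set
open scoped NNReal ENNReal

/-- A pure Hider strategy for two objects in `n` locations: object `j` is buried in location `loc j`
at depth `depth j`, and the depths of the deepest objects in the `n` locations add up to at most `1`
(a location without objects contributes `0`). Both objects may share a location, or even a point. -/
structure Placement (n : ℕ) where
  loc : Fin 2 → Fin n
  depth : Fin 2 → ℝ≥0
  budget : ∑ i : Fin n, (Finset.univ.filter (fun j => loc j = i)).sup depth ≤ 1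

/-- A way of digging in `n` locations at total speed one: `depth t i` is the depth reached in
location `i` when the total depth dug is `t`. Digging in several locations at the same time is
allowed. -/
structure DigPath (n : ℕ) where
  depth : ℝ≥0 → Fin n → ℝ≥0
  mono : Monotone depth
  total : ∀ t, ∑ i, depth t i = t

/-- A pure adaptive Searcher strategy against two objects. The Searcher follows `stage1` until the
first discovery; if this is an object at depth `d` in location `i`, he then follows `stage2 i d`.
The field `agree` says that `stage2 i d` continues what was dug before that discovery. (Both paths
are continuous, so they also agree at the time of the discovery.) -/
structure SearchStrategy (n : ℕ) where
  stage1 : DigPath n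
  stage2 : Fin n → ℝ≥0 → DigPath n
  agree : ∀ i d t, stage1.depth t i < d → (stage2 i d).depth t = stage1.depth t

/-- Along `stage1`, object `j` is discovered no later than the other object. -/
def SearchStrategy.DiscoversFirst {n : ℕ} (s : SearchStrategy n) (x : Placement n) (j : Fin 2) :
    Prop :=
  ∀ j' t, x.depth j' ≤ s.stage1.depth t (x.loc j') → x.depth j ≤ s.stage1.depth t (x.loc j)

/-- The Searcher, who may dig a total depth `h`, finds both objects. (If both objects are discovered
at the same instant, either of them may be taken as the first one; the outcome is the same.) -/
def SearchStrategy.Wins {n : ℕ} (s : SearchStrategy n) (h : ℝ≥0) (x : Placement n) : Prop :=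
  ∃ j, s.DiscoversFirst x j ∧
    ∀ j', x.depth j' ≤ (s.stage2 (x.loc j) (x.depth j)).depth h (x.loc j')

/-- Lower (maximin) value: the supremum of the winning probabilities that the Searcher can guarantee
by a (discrete) mixed strategy. -/
noncomputable def lowerValue (n : ℕ) (h : ℝ≥0) : ℝ :=
  (⨆ p : PMF (SearchStrategy n), ⨅ x : Placement n, p.toOuterMeasure {s | s.Wins h x}).toReal

/-- Upper (minimax) value: the infimum of the bounds on the Searcher's winning probability that the
Hider can guarantee by a (discrete) mixed strategy. -/
noncomputable def upperValue (n : ℕ) (h : ℝ≥0) : ℝ :=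
  (⨅ q : PMF (Placement n), ⨆ s : SearchStrategy n, q.toOuterMeasure {x | s.Wins h x}).toReal

/-!
The upper bound comes from the Hider who puts both objects at depth `1` in a uniformly random
location: until he digs to depth `1` somewhere the Searcher learns nothing, so he wins only in
locations which `stage1` digs to depth `1`, and there are at most `⌊h⌋` of them
(`upperValue_le`). The middle inequality is weak duality (`lowerValue_le_upperValue`).

For the lower bound put `k = ⌊h⌋`. The Searcher picks a set `S` of `k` locations and a location
`p ∉ S`, and digs the locations of `S` in parallel. When he finds the first object, at depth `d` in
location `i ∈ S`, he digs `i` to depth `1`, the rest of `S` to `max d (1 - d)`, and every other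
location except `p` to `min d (1 - d)`. With `M = max d (1 - d) ∈ [1/2, 1]` the total depth is
`k M + (n - k) (1 - M) = (2 M - 1) k + (1 - M) n`, a convex combination of `k` and `n / 2`, hence at
most `h` (`sum_target_le`). This wins whenever the location of the deeper object is in `S` and that
of the other one is not `p` (`coverStrategy_wins`): if both locations are in `S`, the shallower
object is found first and the deeper one lies in the same location or at depth at most `1 - d`; if
only the deeper one is in `S`, it is found first (unless the other lies on the surface), and the
other one has depth at most `min d (1 - d)`. Letting `S` be a cyclic interval and `p` the location
that follows it, rotated uniformly at random, the deeper object is in `S` with probability `k / n`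
and the other one in `p` with probability `1 / n`, so the Searcher wins with probability at least
`(k - 1) / n ≥ (h - 2) / n`.
-/

/-! ### Placements -/

theorem Placement.depth_le_sup {n : ℕ} (x : Placement n) (j : Fin 2) :
    x.depth j ≤ (Finset.univ.filter (fun j' => x.loc j' = x.loc j)).sup x.depth :=
  Finset.le_sup (f := x.depth) (by simp)

theorem Placement.depth_le_one {n : ℕ} (x : Placement n) (j : Fin 2) : x.depth j ≤ 1 :=
  (x.depth_le_sup j).trans <|
    (Finset.single_le_sum
      (f := fun i => (Finset.univ.filter (fun j' => x.loc j' = i)).sup x.depth)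
      (fun _ _ => zero_le) (Finset.mem_univ (x.loc j))).trans x.budget

theorem Placement.depth_add_depth_le_one {n : ℕ} (x : Placement n) {i j : Fin 2}
    (hij : x.loc i ≠ x.loc j) : x.depth i + x.depth j ≤ 1 := by
  refine (add_le_add (x.depth_le_sup i) (x.depth_le_sup j)).trans (le_trans ?_ x.budget)
  rw [← Finset.sum_pair
    (f := fun l => (Finset.univ.filter (fun j' => x.loc j' = l)).sup x.depth) hij]
  exact Finset.sum_le_sum_of_subset (Finset.subset_univ _)

/-- Both objects at depth `1` in location `r`. -/
def Placement.bothAt {n : ℕ} (r : Fin n) : Placement n where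
  loc _ := r
  depth _ := 1
  budget := by
    rw [Finset.sum_eq_single r]
    · exact Finset.sup_le fun _ _ => le_rfl
    · intro b _ hb
      simp [Ne.symm hb]
    · simp

/-! ### The Hider's bound and weak duality -/

theorem one_le_stage1_of_wins_bothAt {n : ℕ} (s : SearchStrategy n) (h : ℝ≥0) (r : Fin n)
    (hw : s.Wins h (Placement.bothAt r)) : 1 ≤ s.stage1.depth h r := by
  obtain ⟨j, -, hj⟩ := hw
  have h1 : (1 : ℝ≥0) ≤ (s.stage2 r 1).depth h r := hj j
  by_contra! hlt
  rw [s.agree r 1 h hlt] at h1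
  exact absurd h1 (not_le.mpr hlt)

theorem DigPath.card_one_le_depth_le {n : ℕ} (P : DigPath n) (h : ℝ≥0) :
    (Finset.univ.filter (fun r => 1 ≤ P.depth h r)).card ≤ ⌊h⌋₊ := by
  refine Nat.le_floor ?_
  calc (((Finset.univ.filter (fun r => 1 ≤ P.depth h r)).card : ℕ) : ℝ≥0)
      = ∑ r ∈ Finset.univ.filter (fun r => 1 ≤ P.depth h r), (1 : ℝ≥0) := by simp
    _ ≤ ∑ r ∈ Finset.univ.filter (fun r => 1 ≤ P.depth h r), P.depth h r :=
        Finset.sum_le_sum fun r hr => (Finset.mem_filter.mp hr).2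
    _ ≤ ∑ r, P.depth h r := Finset.sum_le_sum_of_subset (Finset.subset_univ _)
    _ = h := P.total h

theorem PMF.toOuterMeasure_le_one {α : Type*} (p : PMF α) (s : Set α) :
    p.toOuterMeasure s ≤ 1 := by
  rw [PMF.toOuterMeasure_apply, ← p.tsum_coe]
  exact ENNReal.tsum_le_tsum fun a => Set.indicator_le_self _ _ a

/-- The image of the uniform distribution gives a set the proportion of the points mapped to it. -/
theorem PMF.toOuterMeasure_map_uniform {α β : Type*} [Fintype α] [Nonempty α] (f : α → β)
    (s : Set β) [DecidablePred fun a => f a ∈ s] :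
    ((PMF.uniformOfFintype α).map f).toOuterMeasure s =
      ((Finset.univ.filter fun a => f a ∈ s).card : ℝ≥0∞) / Fintype.card α := by
  classical
  rw [PMF.toOuterMeasure_map_apply, PMF.toOuterMeasure_uniformOfFintype_apply,
    Fintype.card_subtype]
  congr!

/-- Weak duality: exchange the order of summation in the probability of `{(a, b) | R a b}`. -/
theorem PMF.iSup_iInf_le_iInf_iSup {α β : Type*} (R : α → β → Prop) :
    (⨆ p : PMF α, ⨅ b, p.toOuterMeasure {a | R a b}) ≤
      ⨅ q : PMF β, ⨆ a, q.toOuterMeasure {b | R a b} := by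
  classical
  refine iSup_le fun p => le_iInf fun q => ?_
  calc (⨅ b, p.toOuterMeasure {a | R a b})
      = ∑' b, q b * ⨅ b, p.toOuterMeasure {a | R a b} := by
        rw [ENNReal.tsum_mul_right, q.tsum_coe, one_mul]
    _ ≤ ∑' b, q b * p.toOuterMeasure {a | R a b} :=
        ENNReal.tsum_le_tsum fun b => mul_le_mul_right (iInf_le _ b) _
    _ = ∑' b, ∑' a, q b * (if R a b then p a else 0) := by
        simp_rw [PMF.toOuterMeasure_apply, ← ENNReal.tsum_mul_left, Set.indicator_apply,
          Set.mem_ofPred_eq]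
    _ = ∑' a, ∑' b, p a * (if R a b then q b else 0) := by
        rw [ENNReal.tsum_comm]
        refine tsum_congr fun a => tsum_congr fun b => ?_
        split_ifs <;> simp [mul_comm]
    _ = ∑' a, p a * q.toOuterMeasure {b | R a b} := by
        simp_rw [PMF.toOuterMeasure_apply, ← ENNReal.tsum_mul_left, Set.indicator_apply,
          Set.mem_ofPred_eq]
    _ ≤ ∑' a, p a * ⨆ a, q.toOuterMeasure {b | R a b} :=
        ENNReal.tsum_le_tsum fun a =>
          mul_le_mul_right (le_iSup (fun a => q.toOuterMeasure {b | R a b}) a) _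
    _ = ⨆ a, q.toOuterMeasure {b | R a b} := by
        rw [ENNReal.tsum_mul_right, p.tsum_coe, one_mul]

theorem iInf_iSup_le {n : ℕ} (hn : 0 < n) (h : ℝ≥0) :
    (⨅ q : PMF (Placement n), ⨆ s : SearchStrategy n, q.toOuterMeasure {x | s.Wins h x}) ≤
      (⌊h⌋₊ : ℝ≥0∞) / n := by
  classical
  have : Nonempty (Fin n) := ⟨⟨0, hn⟩⟩
  refine (iInf_le _ ((PMF.uniformOfFintype (Fin n)).map Placement.bothAt)).trans
    (iSup_le fun s => ?_)
  rw [PMF.toOuterMeasure_map_uniform, Fintype.card_fin]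
  refine ENNReal.div_le_div_right (Nat.cast_le.mpr ?_) _
  exact (Finset.card_le_card fun r hr => by
    simpa using one_le_stage1_of_wins_bothAt s h r (by simpa using hr)).trans
    (s.stage1.card_one_le_depth_le h)

theorem upperValue_le {n : ℕ} (hn : 0 < n) (h : ℝ≥0) : upperValue n h ≤ (⌊h⌋₊ : ℝ) / n := by
  have := ENNReal.toReal_mono
    (ENNReal.div_ne_top (ENNReal.natCast_ne_top _) (by simpa using hn.ne')) (iInf_iSup_le hn h)
  simpa [upperValue, ENNReal.toReal_div] using this

theorem lowerValue_le_upperValue {n : ℕ} (hn : 0 < n) (h : ℝ≥0) :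
    lowerValue n h ≤ upperValue n h :=
  ENNReal.toReal_mono
    (ne_top_of_le_ne_top
      (ENNReal.div_ne_top (ENNReal.natCast_ne_top _) (by simpa using hn.ne'))
      (iInf_iSup_le hn h))
    (PMF.iSup_iInf_le_iInf_iSup fun (s : SearchStrategy n) x => s.Wins h x)

/-! ### Digging paths -/

/-- A path can be redirected after time `t₀` so as to reach any profile `w` above its current one
whose total depth is affordable. -/
theorem DigPath.exists_extension {n : ℕ} (P : DigPath n) {t₀ h : ℝ≥0} (ht : t₀ ≤ h)
    (w : Fin n → ℝ≥0) (hPw : P.depth t₀ ≤ w) (hw : ∑ l, w l ≤ h) :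
    ∃ Q : DigPath n, (∀ t ≤ t₀, Q.depth t = P.depth t) ∧ w ≤ Q.depth h := by
  rcases ht.eq_or_lt with rfl | hlt
  · -- There is no time left, so the profile `w` has been reached already.
    refine ⟨P, fun _ _ => rfl, fun l => ?_⟩
    have hsum : ∑ l, P.depth t₀ l = ∑ l, w l :=
      le_antisymm (Finset.sum_le_sum fun l _ => hPw l) (by rwa [P.total])
    exact ((Finset.sum_eq_sum_iff_of_le fun l _ => hPw l).mp hsum l (Finset.mem_univ l)).ge
  -- A unit direction which moves from `P.depth t₀` to a profile above `w` in time `h - t₀`; the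
  -- unused digging goes into an arbitrary location.
  obtain ⟨v, hv, hvw⟩ : ∃ v : Fin n → ℝ≥0, ∑ l, v l = 1 ∧
      ∀ l, w l ≤ P.depth t₀ l + (h - t₀) * v l := by
    have hn : Nonempty (Fin n) := by
      by_contra hne
      rw [not_nonempty_iff] at hne
      have := P.total h
      simp only [Finset.univ_eq_empty, Finset.sum_empty] at this
      exact absurd (this ▸ hlt) (by simp)
    obtain ⟨i⟩ := hn
    have hpos : h - t₀ ≠ 0 := (tsub_pos_of_lt hlt).ne'
    refine ⟨fun l => (w l - P.depth t₀ l + if l = i then h - ∑ l, w l else 0) / (h - t₀), ?_,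
      fun l => ?_⟩
    · rw [← Finset.sum_div, Finset.sum_add_distrib, Finset.sum_ite_eq' Finset.univ i,
        if_pos (Finset.mem_univ i), div_eq_one_iff_eq hpos]
      have h1 : ∑ l, (w l - P.depth t₀ l) + t₀ = ∑ l, w l := by
        conv_lhs => rw [← P.total t₀]
        rw [← Finset.sum_add_distrib]
        refine Finset.sum_congr rfl fun l _ => ?_
        rw [P.total t₀]
        exact tsub_add_cancel_of_le (hPw l)
      refine (tsub_eq_of_eq_add ?_).symm
      rw [add_right_comm, h1, add_tsub_cancel_of_le hw]
    · rw [mul_div_cancel₀ _ hpos, ← add_assoc, add_tsub_cancel_of_le (hPw l)]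
      exact le_self_add
  refine ⟨⟨fun t l => if t ≤ t₀ then P.depth t l else P.depth t₀ l + (t - t₀) * v l, ?_, ?_⟩,
    fun t ht' => ?_, fun l => ?_⟩
  · intro s t hst l
    by_cases h1 : t ≤ t₀
    · simpa [h1, hst.trans h1] using P.mono hst l
    · by_cases h2 : s ≤ t₀
      · simpa [h1, h2] using (P.mono h2 l).trans le_self_add
      · simp only [h1, h2, if_false]
        gcongr
  · intro t
    by_cases h1 : t ≤ t₀
    · simpa [h1] using P.total t
    · simp only [h1, if_false]
      rw [Finset.sum_add_distrib, P.total, ← Finset.mul_sum, hv, mul_one]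
      exact add_tsub_cancel_of_le (not_le.mp h1).le
  · funext l
    simp [ht']
  · simpa [not_le.mpr hlt] using hvw l

/-- Digging the locations of `S` in parallel at equal speed. -/
noncomputable def DigPath.parallel {n : ℕ} (S : Finset (Fin n)) (hS : S.Nonempty) : DigPath n where
  depth t l := if l ∈ S then t / S.card else 0
  mono s t hst l := by
    dsimp only
    split_ifs
    · gcongr
    · exact le_rfl
  total t := by
    have : (S.card : ℝ≥0) ≠ 0 := by simpa using hS.ne_empty
    rw [Finset.sum_ite_mem, Finset.univ_inter, Finset.sum_const, nsmul_eq_mul,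
      mul_div_cancel₀ _ this]

/-! ### The Searcher's strategy -/

/-- The depths to be reached after a first discovery at depth `d` in location `i ∈ S`: any second
object which is in `i`, or in `S` and not shallower, or outside `S ∪ {p}` and not deeper, is then
found. -/
noncomputable def target {n : ℕ} (S : Finset (Fin n)) (p i : Fin n) (d : ℝ≥0) (l : Fin n) : ℝ≥0 :=
  if l = i then 1 else if l ∈ S then max d (1 - d) else if l = p then 0 else min d (1 - d)

theorem sum_target_le {n : ℕ} {S : Finset (Fin n)} {p i : Fin n} (hp : p ∉ S) (hi : i ∈ S)
    {d h : ℝ≥0} (hd : d ≤ 1) (hS : (S.card : ℝ≥0) ≤ h) (hh : (n : ℝ≥0) / 2 ≤ h) :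
    ∑ l, target S p i d l ≤ h := by
  have hsplit : ∑ l, target S p i d l = 1 + (S.card - 1 : ℕ) * max d (1 - d) +
      ((n - S.card - 1 : ℕ) : ℝ≥0) * min d (1 - d) := by
    have h1 : ∑ l ∈ S, target S p i d l = 1 + (S.card - 1 : ℕ) * max d (1 - d) := by
      rw [← Finset.add_sum_erase S _ hi, Finset.sum_congr rfl (g := fun _ => max d (1 - d)),
        Finset.sum_const, Finset.card_erase_of_mem hi, nsmul_eq_mul]
      · simp [target]
      · intro l hl
        rw [Finset.mem_erase] at hl
        simp [target, hl.1, hl.2]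
    have h2 : ∑ l ∈ Sᶜ, target S p i d l = ((n - S.card - 1 : ℕ) : ℝ≥0) * min d (1 - d) := by
      have hpi : p ≠ i := fun h => hp (h ▸ hi)
      rw [← Finset.add_sum_erase Sᶜ _ (Finset.mem_compl.mpr hp),
        Finset.sum_congr rfl (g := fun _ => min d (1 - d)), Finset.sum_const,
        Finset.card_erase_of_mem (Finset.mem_compl.mpr hp), Finset.card_compl, Fintype.card_fin,
        nsmul_eq_mul]
      · simp [target, hpi, hp]
      · intro l hl
        rw [Finset.mem_erase, Finset.mem_compl] at hl
        have hli : l ≠ i := fun h => hl.2 (h ▸ hi)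
        simp [target, hl.1, hl.2, hli]
    rw [← Finset.sum_add_sum_compl S, h1, h2]
  have hpos : 1 ≤ S.card := Finset.card_pos.mpr ⟨i, hi⟩
  have hlt : S.card + 1 ≤ n := by
    simpa [hp] using (Finset.card_le_univ (insert p S))
  rw [hsplit, ← NNReal.coe_le_coe]
  have hS' : (S.card : ℝ) ≤ h := by exact_mod_cast hS
  have hh' : (n : ℝ) / 2 ≤ h := by exact_mod_cast hh
  have hcard : ((S.card - 1 : ℕ) : ℝ) = S.card - 1 := by push_cast [hpos]; rfl
  have hcompl : ((n - S.card - 1 : ℕ) : ℝ) = n - (S.card + 1) := by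
    rw [Nat.sub_sub, Nat.cast_sub hlt]
    push_cast
    rfl
  simp only [NNReal.coe_add, NNReal.coe_mul, NNReal.coe_one, NNReal.coe_natCast, NNReal.coe_max,
    NNReal.coe_min, NNReal.coe_sub hd, hcard, hcompl]
  have hd' : (d : ℝ) ≤ 1 := hd
  rcases le_total (d : ℝ) (1 - d) with hle | hle
  · rw [max_eq_right hle, min_eq_left hle]
    nlinarith [mul_nonneg (sub_nonneg.mpr hS') (sub_nonneg.mpr hle),
      mul_nonneg (sub_nonneg.mpr hh') d.coe_nonneg]
  · rw [max_eq_left hle, min_eq_right hle]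
    nlinarith [mul_nonneg (sub_nonneg.mpr hS') (sub_nonneg.mpr hle),
      mul_nonneg (sub_nonneg.mpr hh') (sub_nonneg.mpr hd')]

/-- The continuation after a first discovery at depth `d` in location `i`. -/
theorem exists_continuation {n : ℕ} {S : Finset (Fin n)} (hne : S.Nonempty) {p : Fin n}
    (hp : p ∉ S) {h : ℝ≥0} (hS : (S.card : ℝ≥0) ≤ h) (hh : (n : ℝ≥0) / 2 ≤ h) (i : Fin n)
    (d : ℝ≥0) :
    ∃ Q : DigPath n,
      (∀ t, (DigPath.parallel S hne).depth t i < d →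
        Q.depth t = (DigPath.parallel S hne).depth t) ∧
      (i ∉ S → Q = DigPath.parallel S hne) ∧
      (i ∈ S → d ≤ 1 → target S p i d ≤ Q.depth h) := by
  have hk : (0 : ℝ≥0) < S.card := by exact_mod_cast Finset.card_pos.mpr hne
  by_cases hid : i ∈ S ∧ d ≤ 1
  · obtain ⟨hi, hd⟩ := hid
    obtain ⟨Q, hQ, hQw⟩ := (DigPath.parallel S hne).exists_extension (t₀ := S.card * d) (h := h)
      ((mul_le_of_le_one_right' hd).trans hS) (target S p i d) (fun l => by
        by_cases hl : l ∈ S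
        · by_cases hli : l = i
          · simpa [DigPath.parallel, target, hi, hli, mul_div_cancel_left₀ _ hk.ne'] using hd
          · simp [DigPath.parallel, target, hl, hli, mul_div_cancel_left₀ _ hk.ne']
        · simp [DigPath.parallel, hl]) (sum_target_le hp hi hd hS hh)
    refine ⟨Q, fun t ht => hQ t ?_, fun h => absurd hi h, fun _ _ => hQw⟩
    rw [DigPath.parallel] at ht
    simp only [hi, if_true] at ht
    rw [div_lt_iff₀ hk] at ht
    rw [mul_comm]
    exact ht.le
  · exact ⟨_, fun _ _ => rfl, fun _ => rfl, fun hi hd => absurd ⟨hi, hd⟩ hid⟩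

/-- Dig `S` in parallel until the first discovery, then reach the profile `target`. -/
noncomputable def coverStrategy {n : ℕ} {S : Finset (Fin n)} (hne : S.Nonempty) {p : Fin n}
    (hp : p ∉ S) {h : ℝ≥0} (hS : (S.card : ℝ≥0) ≤ h) (hh : (n : ℝ≥0) / 2 ≤ h) :
    SearchStrategy n where
  stage1 := DigPath.parallel S hne
  stage2 i d := (exists_continuation hne hp hS hh i d).choose
  agree i d := (exists_continuation hne hp hS hh i d).choose_spec.1

theorem coverStrategy_wins {n : ℕ} {S : Finset (Fin n)} (hne : S.Nonempty) {p : Fin n}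
    (hp : p ∉ S) {h : ℝ≥0} (hS : (S.card : ℝ≥0) ≤ h) (hh : (n : ℝ≥0) / 2 ≤ h)
    {x : Placement n} {i j : Fin 2} (hij : i ≠ j) (hle : x.depth i ≤ x.depth j)
    (hj : x.loc j ∈ S) (hi : x.loc i ≠ p) : (coverStrategy hne hp hS hh).Wins h x := by
  have hcases : ∀ j' : Fin 2, j' = i ∨ j' = j := by lia
  have hk : (0 : ℝ≥0) < S.card := by exact_mod_cast Finset.card_pos.mpr hne
  have hspec := fun l d => (exists_continuation hne hp hS hh l d).choose_spec.2
  by_cases hiS : x.loc i ∈ S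
  · -- Both locations are dug in parallel, so the shallower object is found first.
    refine ⟨i, fun j' t ht => ?_, fun j' => ?_⟩
    · rcases hcases j' with rfl | rfl
      · exact ht
      · simp only [coverStrategy, DigPath.parallel, hj, hiS, if_true] at ht ⊢
        exact hle.trans ht
    · refine le_trans ?_ ((hspec (x.loc i) (x.depth i)).2 hiS (x.depth_le_one i) (x.loc j'))
      by_cases hl : x.loc j' = x.loc i
      · simpa [target, hl] using x.depth_le_one j'
      · rcases hcases j' with rfl | rfl
        · exact absurd rfl hl
        · simp only [target, hl, hj, if_false, if_true]
          exact le_max_of_le_right (le_tsub_of_add_le_right (x.depth_add_depth_le_one hl))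
  have hne' : x.loc i ≠ x.loc j := fun h => hiS (h ▸ hj)
  rcases eq_or_ne (x.depth i) 0 with h0 | h0
  · -- An object on the surface is found at once, and the Searcher just goes on digging `S`.
    refine ⟨i, fun _ _ _ => by simp [h0], fun j' => ?_⟩
    change _ ≤ (exists_continuation hne hp hS hh (x.loc i) (x.depth i)).choose.depth h _
    rw [(hspec (x.loc i) (x.depth i)).1 hiS]
    rcases hcases j' with rfl | rfl
    · simp [h0]
    · simp only [DigPath.parallel, hj, if_true]
      exact (x.depth_le_one _).trans ((one_le_div hk).mpr hS)
  · -- The location of the shallower object is not dug before the first discovery.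
    refine ⟨j, fun j' t ht => ?_, fun j' => ?_⟩
    · rcases hcases j' with rfl | rfl
      · simp [coverStrategy, DigPath.parallel, hiS, h0] at ht
      · exact ht
    · refine le_trans ?_ ((hspec (x.loc j) (x.depth j)).2 hj (x.depth_le_one j) (x.loc j'))
      rcases hcases j' with rfl | rfl
      · simp only [target, hne', hiS, hi, if_false]
        exact le_min hle (le_tsub_of_add_le_right (x.depth_add_depth_le_one hne'))
      · simpa [target] using x.depth_le_one j'

/-! ### Rotating the strategy -/

/-- The cyclic interval of the `k` locations that start at `r`. -/
def cyclicInterval {n : ℕ} [NeZero n] (k : ℕ) (r : Fin n) : Finset (Fin n) :=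
  Finset.univ.filter fun l => (l - r).val < k

theorem card_cyclicInterval {n : ℕ} [NeZero n] {k : ℕ} (hk : k < n) (r : Fin n) :
    (cyclicInterval k r).card = k := by
  rw [cyclicInterval, Finset.card_equiv (t := Finset.univ.filter fun l : Fin n => l.val < k)
    (Equiv.subRight r) (by simp)]
  rw [Fin.card_filter_val_lt, min_eq_right hk.le]

theorem cyclicInterval_nonempty {n : ℕ} [NeZero n] {k : ℕ} (hk : k < n) (hk0 : 0 < k)
    (r : Fin n) : (cyclicInterval k r).Nonempty :=
  Finset.card_pos.mp (by rwa [card_cyclicInterval hk])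

theorem add_notMem_cyclicInterval {n : ℕ} [NeZero n] {k : ℕ} (hk : k < n) (r : Fin n) :
    r + ⟨k, hk⟩ ∉ cyclicInterval k r := by
  simp [cyclicInterval]

/-- Among the `n` rotations, `k` put a given location `a` into the interval, and only one puts the
location that follows the interval at a given `b`. -/
theorem le_card_rotations {n : ℕ} [NeZero n] {k : ℕ} (hk : k < n) (a b : Fin n) :
    k - 1 ≤ (Finset.univ.filter fun r : Fin n =>
      a ∈ cyclicInterval k r ∧ b ≠ r + ⟨k, hk⟩).card := by
  have h1 : (Finset.univ.filter fun r : Fin n => a ∈ cyclicInterval k r).card = k := by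
    rw [Finset.card_equiv (t := Finset.univ.filter fun l : Fin n => l.val < k)
      (Equiv.subLeft a) (by simp [cyclicInterval])]
    rw [Fin.card_filter_val_lt, min_eq_right hk.le]
  calc k - 1 ≤ ((Finset.univ.filter fun r : Fin n => a ∈ cyclicInterval k r).erase
        (b - ⟨k, hk⟩)).card := by
        conv_lhs => rw [← h1]
        exact Finset.pred_card_le_card_erase
    _ ≤ _ := Finset.card_le_card fun r hr => by
        rw [Finset.mem_erase, Finset.mem_filter] at hr
        rw [Finset.mem_filter]
        exact ⟨Finset.mem_univ r, hr.2.2, fun hb => hr.1 (by rw [hb, add_sub_cancel_right])⟩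

theorem le_iSup_iInf {n : ℕ} {h : ℝ≥0} (h1 : 1 ≤ h) (hn : h < n) (hh : (n : ℝ≥0) / 2 ≤ h) :
    ((⌊h⌋₊ - 1 : ℕ) : ℝ≥0∞) / n ≤
      ⨆ p : PMF (SearchStrategy n), ⨅ x : Placement n, p.toOuterMeasure {s | s.Wins h x} := by
  classical
  have hk0 : 0 < ⌊h⌋₊ := Nat.floor_pos.mpr h1
  have hk : ⌊h⌋₊ < n := (Nat.floor_lt zero_le).mpr hn
  have : NeZero n := ⟨by lia⟩
  let strat (r : Fin n) : SearchStrategy n :=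
    coverStrategy (cyclicInterval_nonempty hk hk0 r) (add_notMem_cyclicInterval hk r)
      (h := h) (by rw [card_cyclicInterval hk]; exact Nat.floor_le zero_le) hh
  refine le_iSup_of_le ((PMF.uniformOfFintype (Fin n)).map strat) (le_iInf fun x => ?_)
  rw [PMF.toOuterMeasure_map_uniform, Fintype.card_fin]
  refine ENNReal.div_le_div_right (Nat.cast_le.mpr ?_) _
  obtain ⟨i, j, hij, hle⟩ : ∃ i j : Fin 2, i ≠ j ∧ x.depth i ≤ x.depth j := by
    rcases le_total (x.depth 0) (x.depth 1) with hle | hle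
    · exact ⟨0, 1, by decide, hle⟩
    · exact ⟨1, 0, by decide, hle⟩
  refine (le_card_rotations hk (x.loc j) (x.loc i)).trans (Finset.card_le_card fun r hr => ?_)
  rw [Finset.mem_filter] at hr ⊢
  exact ⟨hr.1, coverStrategy_wins _ _ _ _ hij hle hr.2.1 hr.2.2⟩

theorem le_lowerValue {n : ℕ} {h : ℝ≥0} (h1 : 1 ≤ h) (hn : h < n) (hh : (n : ℝ≥0) / 2 ≤ h) :
    (h : ℝ) / n - 2 / n ≤ lowerValue n h := by
  have hn0 : 0 < n := by
    have : (0 : ℝ≥0) < n := zero_le.trans_lt hn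
    exact_mod_cast this
  have hfin : (⨆ p : PMF (SearchStrategy n), ⨅ x : Placement n,
      p.toOuterMeasure {s | s.Wins h x}) ≠ ⊤ :=
    ne_top_of_le_ne_top ENNReal.one_ne_top <| iSup_le fun p =>
      iInf_le_of_le (Placement.bothAt ⟨0, hn0⟩) (p.toOuterMeasure_le_one _)
  have hlow : ((⌊h⌋₊ - 1 : ℕ) : ℝ) / n ≤ lowerValue n h := by
    have := ENNReal.toReal_mono hfin (le_iSup_iInf h1 hn hh)
    rwa [ENNReal.toReal_div, ENNReal.toReal_natCast, ENNReal.toReal_natCast] at this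
  refine le_trans ?_ hlow
  rw [← sub_div]
  have hfl : (h : ℝ) < ⌊h⌋₊ + 1 := by exact_mod_cast Nat.lt_floor_add_one h
  have hk0 : 1 ≤ ⌊h⌋₊ := Nat.floor_pos.mpr h1
  rw [Nat.cast_sub hk0, Nat.cast_one]
  exact div_le_div_of_nonneg_right (by linarith) n.cast_nonneg

theorem mainTheorem2 :
    (∀ (n : ℕ) (h : ℝ≥0), 1 ≤ h → h < n → (n : ℝ≥0) / 2 ≤ h →
      (h : ℝ) / n - 2 / n ≤ lowerValue n h ∧
      lowerValue n h ≤ upperValue n h ∧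
      upperValue n h ≤ (⌊h⌋₊ : ℝ) / n) ∧
    ∃ ε : ℕ → ℝ, Tendsto ε atTop (𝓝 0) ∧
      ∀ (n : ℕ) (h : ℝ≥0), 1 ≤ h → h < n → (n : ℝ≥0) / 2 ≤ h →
        ∀ V ∈ Set.Icc (lowerValue n h) (upperValue n h), |V - (h : ℝ) / n| ≤ ε n := by
  have hpos : ∀ (n : ℕ) (h : ℝ≥0), h < n → 0 < n := fun n h hn => by
    have : (0 : ℝ≥0) < n := zero_le.trans_lt hn
    exact_mod_cast this
  refine ⟨fun n h h1 hn hh => ⟨le_lowerValue h1 hn hh, lowerValue_le_upperValue (hpos n h hn) h,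
    upperValue_le (hpos n h hn) h⟩, fun n => 2 / n, tendsto_const_div_atTop_nhds_zero_nat 2,
    fun n h h1 hn hh V hV => ?_⟩
  have hlow := (le_lowerValue h1 hn hh).trans hV.1
  have hup := hV.2.trans (upperValue_le (hpos n h hn) h)
  have hfl : (⌊h⌋₊ : ℝ) / n ≤ (h : ℝ) / n := by
    gcongr
    exact_mod_cast Nat.floor_le (zero_le (a := h))
  have h2 : (0 : ℝ) ≤ 2 / n := by positivity
  rw [abs_le]
  constructor <;> linarith
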